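/- For a group $G$, the subgroup graph of $G$ is the simple undirected graph whose vertices are the subgroups of $G$, two distinct subgroups being adjacent if and only if one of them is contained in the other and there is no subgroup strictly between them. Let $G$ be a finite solvable group. Then the subgroup graph of $G$ contains a vertex of degree at least $3|G|/4$ if and only if $G$ is an elementary abelian $2$-group (that is, $G$ is abelian and $x^2=1$ for all $x\in G$) of order at least $4$. -/

import Mathlib

/-- The subgroup graph of `G`: the vertices are the subgroups of `G`, and two distinct subgroups are
adjacent iff one of them is contained in the other and no subgroup lies strictly between them.
This is the Hasse diagram of the subgroup lattice, as a simple undirected graph. -/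
def subgroupGraph (G : Type*) [Group G] : SimpleGraph (Subgroup G) :=
  SimpleGraph.hasse (Subgroup G)

/-- The subgroup graph of a finite group is a finite graph, so its vertices have degrees. -/
noncomputable instance subgroupGraphLocallyFinite (G : Type*) [Group G] [Finite G] :
    (subgroupGraph G).LocallyFinite :=
  fun _ => Fintype.ofFinite _

/-- `G` is an elementary abelian 2-group: it is abelian and every element `x` has `x ^ 2 = 1`.
The trivial group is allowed. -/
def IsElementaryAbelianTwoGroup (G : Type*) [Group G] : Prop :=
  (∀ x y : G, x * y = y * x) ∧ ∀ x : G, x ^ 2 = 1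

/-! The neighbours of `H` are its covers and its maximal subgroups. There are fewer than `|G : H|`
covers (`ncard_covBy_lt_index`) and, `H` being solvable, fewer than `|H|` maximal subgroups. If `H`
is neither `⊥` nor `⊤`, the degree is thus at most `|H| + |G : H| - 2 ≤ |G| / 2`, so only `⊥` and
`⊤` can have large degree.

At `⊥` one counts subgroups of prime order. If `x` has order `4` or an odd prime order, comparing
each `g` with `g * x` shows that there are fewer than `3|G|/4` (`four_mul_ncard_isAtom_lt`).

At `⊤` one counts maximal subgroups by induction on `|G|` (`four_mul_ncard_isCoatom_lt`). Let `A` be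
minimal normal with centralizer `C`. Maximal subgroups containing `A` come from `G ⧸ A`; any other
`M` complements `A`, and `M ⊓ C` is a normal complement of `A` in `C`. There are at most `|C| / |A|`
such complements (`ncard_normalComplements_mul_le`), and if `C ≠ ⊤` each arises from at most `|A|`
subgroups `M`, all conjugate under `A` (`exists_conj_eq_of_inf_centralizer_eq`).

Conversely, in exponent `2` the vertex `⊥` has at least `|G| - 1` neighbours, which suffices once
`|G| ≥ 4`. -/

/-! ### Minimal normal subgroups of solvable groups. -/

/-- `A` is a minimal nontrivial normal subgroup of `G`. -/
structure IsMinimalNormal {G : Type*} [Group G] (A : Subgroup G) : Prop where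
  normal : A.Normal
  ne_bot : A ≠ ⊥
  eq_of_le : ∀ B : Subgroup G, B.Normal → B ≤ A → B ≠ ⊥ → B = A

theorem exists_isMinimalNormal (G : Type*) [Group G] [Finite G] [Nontrivial G] :
    ∃ A : Subgroup G, IsMinimalNormal A := by
  have hne : {B : Subgroup G | B.Normal ∧ B ≠ ⊥}.Nonempty := ⟨⊤, inferInstance, top_ne_bot⟩
  obtain ⟨A, hA⟩ := (Set.toFinite {B : Subgroup G | B.Normal ∧ B ≠ ⊥}).exists_minimal hne
  exact ⟨A, hA.prop.1, hA.prop.2, fun B hB hBA hB0 => le_antisymm hBA (hA.2 ⟨hB, hB0⟩ hBA)⟩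

/-- A minimal normal subgroup of a solvable group is commutative. -/
theorem IsMinimalNormal.commute {G : Type*} [Group G] [Group.IsSolvable G] {A : Subgroup G}
    (hA : IsMinimalNormal A) {x y : G} (hx : x ∈ A) (hy : y ∈ A) : x * y = y * x := by
  have := hA.normal
  have h0 : ⁅A, A⁆ = ⊥ := by
    by_contra h
    have h1 := hA.eq_of_le ⁅A, A⁆ inferInstance (Subgroup.commutator_le_left A A) h
    exact (Group.IsSolvable.commutator_lt_of_ne_bot hA.ne_bot).ne h1
  have h1 := Subgroup.commutator_mem_commutator hx hy
  rw [h0, Subgroup.mem_bot] at h1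
  exact commutatorElement_eq_one_iff_mul_comm.mp h1

/-- A minimal normal subgroup of a finite solvable group is a `p`-group. -/
theorem IsMinimalNormal.exists_isPGroup {G : Type*} [Group G] [Finite G] [Group.IsSolvable G]
    {A : Subgroup G} (hA : IsMinimalNormal A) : ∃ p : ℕ, p.Prime ∧ IsPGroup p A := by
  have := hA.normal
  have hcard : Nat.card A ≠ 1 := by
    rw [Ne, Subgroup.card_eq_one]; exact hA.ne_bot
  obtain ⟨p, hp, hpA⟩ := Nat.exists_prime_and_dvd hcard
  have : Fact p.Prime := ⟨hp⟩
  refine ⟨p, hp, ?_⟩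
  -- The `p`-torsion of the abelian group `A`; it is normal in `G`, and nontrivial by Cauchy.
  let B : Subgroup G :=
    { carrier := {x | x ∈ A ∧ x ^ p = 1}
      one_mem' := ⟨A.one_mem, one_pow p⟩
      mul_mem' := by
        rintro x y ⟨hx, hx'⟩ ⟨hy, hy'⟩
        refine ⟨A.mul_mem hx hy, ?_⟩
        rw [(show Commute x y from hA.commute hx hy).mul_pow, hx', hy', one_mul]
      inv_mem' := by
        rintro x ⟨hx, hx'⟩
        exact ⟨A.inv_mem hx, by rw [inv_pow, hx', inv_one]⟩ }
  have hBA : B ≤ A := fun x hx => hx.1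
  have hBn : B.Normal :=
    ⟨fun x hx g => ⟨hA.normal.conj_mem x hx.1 g, by rw [conj_pow, hx.2, mul_one, mul_inv_cancel]⟩⟩
  have hB0 : B ≠ ⊥ := by
    obtain ⟨a, ha⟩ := exists_prime_orderOf_dvd_card' (G := A) p hpA
    intro h
    have h1 : (a : G) ∈ B := by
      refine ⟨a.2, ?_⟩
      have := pow_orderOf_eq_one a
      rw [ha] at this
      exact_mod_cast congrArg Subtype.val this
    rw [h, Subgroup.mem_bot] at h1
    have : a = 1 := Subtype.ext h1
    rw [this, orderOf_one] at ha
    exact hp.one_lt.ne ha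
  have hB := hA.eq_of_le B hBn hBA hB0
  intro a
  refine ⟨1, Subtype.ext ?_⟩
  have : (a : G) ∈ B := hB.ge a.2
  simpa using this.2

/-! ### Counting normal complements. -/

/-- The nontrivial half of Dedekind's modular law. -/
theorem Subgroup.sup_inf_le_of_normal {G : Type*} [Group G] {A B X : Subgroup G} [A.Normal]
    (hBX : B ≤ X) : (A ⊔ B) ⊓ X ≤ (A ⊓ X) ⊔ B := by
  rintro x ⟨hx, hxX⟩
  obtain ⟨a, ha, b, hb, rfl⟩ := Subgroup.mem_sup_of_normal_left.mp hx
  refine Subgroup.mul_mem_sup ⟨ha, ?_⟩ hb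
  simpa using X.mul_mem hxX (X.inv_mem (hBX hb))

theorem Subgroup.card_sup_of_inf_eq_bot {G : Type*} [Group G] {A B : Subgroup G} [A.Normal]
    (h : A ⊓ B = ⊥) : Nat.card ↥(A ⊔ B) = Nat.card A * Nat.card B := by
  rw [← Nat.card_prod]
  symm
  refine Nat.card_eq_of_bijective
    (fun x : A × B => (⟨x.1 * x.2, Subgroup.mul_mem_sup x.1.2 x.2.2⟩ : ↥(A ⊔ B))) ⟨?_, ?_⟩
  · intro x y hxy
    exact Subgroup.mul_injective_of_disjoint (disjoint_iff.mpr h) (congrArg Subtype.val hxy)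
  · rintro ⟨x, hx⟩
    obtain ⟨a, ha, b, hb, rfl⟩ := Subgroup.mem_sup_of_normal_left.mp hx
    exact ⟨(⟨a, ha⟩, ⟨b, hb⟩), rfl⟩

theorem Set.ncard_le_mul_ncard_of_fiber {α β : Type*} {s : Set α} {t : Set β} (hs : s.Finite)
    (ht : t.Finite) (f : α → β) (n : ℕ) (hf : ∀ a ∈ s, f a ∈ t)
    (hn : ∀ a₀ ∈ s, {a ∈ s | f a = f a₀}.ncard ≤ n) : s.ncard ≤ n * t.ncard := by
  classical
  rw [Set.ncard_eq_toFinset_card s hs, Set.ncard_eq_toFinset_card t ht]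
  refine Finset.card_le_mul_card_image_of_maps_to (f := f) (by simpa using hf) n fun b _ => ?_
  by_cases hb : ∃ a₀ ∈ s, f a₀ = b
  · obtain ⟨a₀, ha₀, rfl⟩ := hb
    convert hn a₀ ha₀
    rw [← Set.ncard_coe_finset]
    congr 1
    ext a
    simp
  · rw [Finset.card_eq_zero.mpr]
    · exact Nat.zero_le n
    · ext a
      simpa using fun ha h => hb ⟨a, ha, h⟩

/-- The normal subgroups of `G` that contain `K` and are complements of `A` in `X`. -/
def normalComplements {G : Type*} [Group G] (A K X : Subgroup G) : Set (Subgroup G) :=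
  {D | D.Normal ∧ K ≤ D ∧ A ⊓ D = ⊥ ∧ A ⊔ D = X}

theorem inf_mem_normalComplements {G : Type*} [Group G] {A K X Y D : Subgroup G}
    [A.Normal] [Y.Normal] (hAY : A ≤ Y) (hKY : K ≤ Y) (hYX : Y ≤ X)
    (hD : D ∈ normalComplements A K X) : D ⊓ Y ∈ normalComplements A K Y := by
  obtain ⟨hDn, hKD, hAD, hADX⟩ := hD
  refine ⟨inferInstance, le_inf hKD hKY, ?_, ?_⟩
  · rw [← inf_assoc, hAD, bot_inf_eq]
  · refine le_antisymm (sup_le hAY inf_le_right) ?_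
    have h : (D ⊔ A) ⊓ Y ≤ (D ⊓ Y) ⊔ A := Subgroup.sup_inf_le_of_normal hAY
    rwa [sup_comm D, hADX, inf_eq_right.mpr hYX, sup_comm] at h

/-- If `X / Y` is a chief factor, then at most `|X / Y|` normal complements of `A` in `X` have a
given intersection with `Y`. -/
theorem ncard_normalComplements_fiber_le {G : Type*} [Group G] [Finite G] {A K X Y D₀ : Subgroup G}
    (hA : IsMinimalNormal A) [hY : Y.Normal] (hAY : A ≤ Y) (hYX : Y ≤ X)
    (hmax : ∀ Z : Subgroup G, Z.Normal → Y < Z → Z ≤ X → Z = X)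
    (hD₀ : D₀ ∈ normalComplements A K X) :
    {D ∈ normalComplements A K X | D ⊓ Y = D₀ ⊓ Y}.ncard ≤ Y.relIndex X := by
  have hAn := hA.normal
  have hD₀n := hD₀.1
  obtain ⟨a₀, ha, ha1⟩ := (Subgroup.bot_or_exists_ne_one A).resolve_left hA.ne_bot
  have hnot : ∀ D ∈ normalComplements A K X, a₀ ∉ D := fun D hD h => by
    have : a₀ ∈ A ⊓ D := ⟨ha, h⟩
    rw [hD.2.2.1, Subgroup.mem_bot] at this
    exact ha1 this
  -- distinct complements in the same fiber meet inside `Y`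
  have hle : ∀ D ∈ normalComplements A K X, ∀ E ∈ normalComplements A K X, D ⊓ Y = E ⊓ Y →
      ∀ d ∈ D, d ∈ E → d ∉ Y → D ≤ E := by
    intro D hD E hE hDE d hdD hdE hdY
    have := hD.1
    have := hE.1
    have hZ : Y ⊔ (D ⊓ E) = X := by
      refine hmax _ inferInstance (lt_of_le_of_ne le_sup_left fun h => hdY ?_) ?_
      · rw [h]; exact Subgroup.mem_sup_right ⟨hdD, hdE⟩
      · exact sup_le hYX (inf_le_left.trans (le_sup_right.trans hD.2.2.2.le))
    have h1 : (Y ⊔ (D ⊓ E)) ⊓ D ≤ (Y ⊓ D) ⊔ (D ⊓ E) := Subgroup.sup_inf_le_of_normal inf_le_left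
    rw [hZ, inf_eq_right.mpr (le_sup_right.trans hD.2.2.2.le), inf_comm Y, hDE] at h1
    exact h1.trans (sup_le inf_le_left inf_le_right)
  -- For `D ≠ D₀`, `D₀ ⊔ D` meets `A` nontrivially, hence contains `a₀`; splitting `a₀` gives `d ∈
  -- D₀` with `d * a₀ ∈ D`. The class of `d` modulo `Y` will determine `D`, the trivial class being
  -- left for `D₀`.
  have key : ∀ D : Subgroup G, ∃ d : G, D ∈ normalComplements A K X →
      d ∈ D₀ ∧ ((D = D₀ ∧ d = 1) ∨ (D ≠ D₀ ∧ d * a₀ ∈ D)) := by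
    intro D
    by_cases hD : D ∈ normalComplements A K X
    · by_cases h : D = D₀
      · exact ⟨1, fun _ => ⟨D₀.one_mem, Or.inl ⟨h, rfl⟩⟩⟩
      have := hD.1
      have hcard : Nat.card D = Nat.card D₀ := by
        have h1 := Subgroup.card_sup_of_inf_eq_bot hD.2.2.1
        have h2 := Subgroup.card_sup_of_inf_eq_bot hD₀.2.2.1
        rw [hD.2.2.2] at h1
        rw [hD₀.2.2.2, h1] at h2
        exact Nat.eq_of_mul_eq_mul_left Nat.card_pos h2
      have hA' : (D₀ ⊔ D) ⊓ A = A := by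
        refine hA.eq_of_le _ inferInstance inf_le_right fun h0 => h ?_
        have h1 : (A ⊔ D) ⊓ (D₀ ⊔ D) ≤ (A ⊓ (D₀ ⊔ D)) ⊔ D :=
          Subgroup.sup_inf_le_of_normal le_sup_right
        rw [inf_comm A, h0, bot_sup_eq, hD.2.2.2, inf_eq_right.mpr (sup_le
          (le_sup_right.trans hD₀.2.2.2.le) (le_sup_right.trans hD.2.2.2.le))] at h1
        exact (Subgroup.eq_of_le_of_card_ge (le_sup_left.trans h1) hcard.le).symm
      have hmem : a₀ ∈ D₀ ⊔ D := (hA'.ge ha).1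
      obtain ⟨d, hd, e, he, hde⟩ := Subgroup.mem_sup_of_normal_left.mp hmem
      exact ⟨d⁻¹, fun _ => ⟨D₀.inv_mem hd, Or.inr ⟨h, by rw [← hde]; simpa using he⟩⟩⟩
    · exact ⟨1, fun h => absurd h hD⟩
  choose e he using key
  have hcard : (X.map (QuotientGroup.mk' Y) : Set (G ⧸ Y)).ncard = Y.relIndex X := by
    have h1 := Subgroup.relIndex_ker (QuotientGroup.mk' Y) (K := X)
    rw [QuotientGroup.ker_mk'] at h1
    rw [h1]; rfl
  rw [← hcard]
  refine Set.ncard_le_ncard_of_injOn (fun D => QuotientGroup.mk' Y (e D)) ?_ ?_ (Set.toFinite _)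
  · rintro D ⟨hD, -⟩
    exact ⟨e D, le_sup_right.trans hD₀.2.2.2.le (he D hD).1, rfl⟩
  rintro D ⟨hD, hDY⟩ E ⟨hE, hEY⟩ hDE
  have hp : (e D)⁻¹ * e E ∈ D₀ ⊓ Y :=
    ⟨D₀.mul_mem (D₀.inv_mem (he D hD).1) (he E hE).1, QuotientGroup.eq.mp hDE⟩
  have hpD : (e D)⁻¹ * e E ∈ D := (hDY.ge hp).1
  have hpE : (e D)⁻¹ * e E ∈ E := (hEY.ge hp).1
  have hout : ∀ F ∈ normalComplements A K X, F ⊓ Y = D₀ ⊓ Y → F ≠ D₀ → e F ∉ Y := by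
    intro F hF hFY hne h
    obtain ⟨h1, ⟨h2, -⟩ | ⟨-, h2⟩⟩ := he F hF
    · exact hne h2
    · have : e F ∈ F ⊓ Y := hFY.ge ⟨h1, h⟩
      exact hnot F hF (by simpa using F.mul_mem (F.inv_mem this.1) h2)
  by_cases h1 : D = D₀ <;> by_cases h2 : E = D₀
  · rw [h1, h2]
  · obtain ⟨-, ⟨-, h3⟩ | ⟨h3, -⟩⟩ := he D hD
    · exact absurd (by simpa [h3] using hp.2) (hout E hE hEY h2)
    · exact absurd h1 h3
  · obtain ⟨-, ⟨-, h3⟩ | ⟨h3, -⟩⟩ := he E hE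
    · exact absurd (by simpa [h3] using hp.2) (hout D hD hDY h1)
    · exact absurd h2 h3
  · obtain ⟨-, ⟨h3, -⟩ | ⟨-, h3⟩⟩ := he D hD
    · exact absurd h3 h1
    obtain ⟨-, ⟨h4, -⟩ | ⟨-, h4⟩⟩ := he E hE
    · exact absurd h4 h2
    -- Commuting `a₀` past this element of `D₀ ⊓ Y` places `e E * a₀` in both `D` and `E` but
    -- outside `Y`, so `hle` applies both ways.
    have hcomm : Commute a₀ ((e D)⁻¹ * e E) :=
      Subgroup.commute_of_normal_of_disjoint A D₀ hAn hD₀n (disjoint_iff.mpr hD₀.2.2.1) _ _ ha hp.1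
    have h5 : e E * a₀ ∈ D := by
      have : e E * a₀ = e D * a₀ * ((e D)⁻¹ * e E) := by
        rw [mul_assoc, hcomm.eq]; group
      rw [this]
      exact D.mul_mem h3 hpD
    have h6 : e E * a₀ ∉ Y := fun h => hout E hE hEY h2 (by
      simpa using Y.mul_mem h (Y.inv_mem (hAY ha)))
    exact le_antisymm (hle D hD E hE (hDY.trans hEY.symm) _ h5 h4 h6)
      (hle E hE D hD (hEY.trans hDY.symm) _ h4 h5 h6)

/-- Descend a chief series from `X` to `A ⊔ K`: each step `Y < X` costs at most a factor `|X : Y|`,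
and `K` is the only possible complement at the end. -/
theorem ncard_normalComplements_mul_le {G : Type*} [Group G] [Finite G] {A : Subgroup G}
    (hA : IsMinimalNormal A) (K : Subgroup G) [hK : K.Normal] (X : Subgroup G) [hX : X.Normal] :
    (normalComplements A K X).ncard * (Nat.card A * Nat.card K) ≤ Nat.card X := by
  have hAn := hA.normal
  induction hn : Nat.card X using Nat.strong_induction_on generalizing X with
  | _ n ih =>
  subst hn
  rcases (normalComplements A K X).eq_empty_or_nonempty with h0 | ⟨D₀, hD₀⟩
  · simp [h0]
  have hAK : A ⊔ K ≤ X := by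
    rw [← hD₀.2.2.2]; exact sup_le_sup_left hD₀.2.1 A
  have hAK0 : A ⊓ K = ⊥ := le_bot_iff.mp ((inf_le_inf_left A hD₀.2.1).trans hD₀.2.2.1.le)
  rcases hAK.eq_or_lt with h1 | h1
  · have hsub : normalComplements A K X ⊆ {K} := by
      intro D hD
      have h2 : (A ⊔ K) ⊓ D ≤ (A ⊓ D) ⊔ K := Subgroup.sup_inf_le_of_normal hD.2.1
      rw [h1, hD.2.2.1, bot_sup_eq, inf_eq_right.mpr (le_sup_right.trans hD.2.2.2.le)] at h2
      exact le_antisymm h2 hD.2.1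
    have h3 : (normalComplements A K X).ncard ≤ 1 := by
      simpa using Set.ncard_le_ncard hsub
    rw [← h1, Subgroup.card_sup_of_inf_eq_bot hAK0, h1]
    exact (Nat.mul_le_mul_right _ h3).trans (one_mul _).le
  · have hne : {Y : Subgroup G | Y.Normal ∧ A ⊔ K ≤ Y ∧ Y < X}.Nonempty :=
      ⟨A ⊔ K, inferInstance, le_rfl, h1⟩
    obtain ⟨Y, hY⟩ :=
      (Set.toFinite {Y : Subgroup G | Y.Normal ∧ A ⊔ K ≤ Y ∧ Y < X}).exists_maximal hne
    obtain ⟨⟨hYn, hAKY, hYX⟩, hYmax⟩ := hY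
    have hAY := le_sup_left.trans hAKY
    have hKY := le_sup_right.trans hAKY
    have hmax : ∀ Z : Subgroup G, Z.Normal → Y < Z → Z ≤ X → Z = X := by
      intro Z hZ hYZ hZX
      by_contra hne
      exact hYZ.not_ge (hYmax ⟨hZ, hAKY.trans hYZ.le, lt_of_le_of_ne hZX hne⟩ hYZ.le)
    have hidx : Y.relIndex X * Nat.card Y = Nat.card X := by
      rw [mul_comm, ← Subgroup.relIndex_bot_left, ← Subgroup.relIndex_bot_left]
      exact Subgroup.relIndex_mul_relIndex _ _ _ bot_le hYX.le
    have hlt : Nat.card Y < Nat.card X := by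
      refine lt_of_le_of_ne (Nat.card_mono (Set.toFinite _) hYX.le) fun h => hYX.ne ?_
      exact Subgroup.eq_of_le_of_card_ge hYX.le h.ge
    have hih := ih _ hlt Y rfl
    have hfib := Set.ncard_le_mul_ncard_of_fiber (s := normalComplements A K X)
      (t := normalComplements A K Y) (Set.toFinite _) (Set.toFinite _) (fun D => D ⊓ Y)
      (Y.relIndex X) (fun D hD => inf_mem_normalComplements hAY hKY hYX.le hD)
      (fun D hD => ncard_normalComplements_fiber_le hA hAY hYX.le hmax hD)
    calc _ ≤ Y.relIndex X * (normalComplements A K Y).ncard * (Nat.card A * Nat.card K) :=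
          Nat.mul_le_mul_right _ hfib
      _ = Y.relIndex X * ((normalComplements A K Y).ncard * (Nat.card A * Nat.card K)) := by ring
      _ ≤ Y.relIndex X * Nat.card Y := Nat.mul_le_mul_left _ hih
      _ = Nat.card X := hidx

/-! ### Maximal subgroups not containing a minimal normal subgroup. -/

theorem sup_eq_top_of_isCoatom_of_not_le {G : Type*} [Group G] {A M : Subgroup G}
    (hM : IsCoatom M) (hAM : ¬ A ≤ M) : A ⊔ M = ⊤ :=
  hM.2 _ (lt_of_le_of_ne le_sup_right fun h => hAM (h ▸ le_sup_left))

/-- `A ⊓ M` is normalized by `M` and centralized by the abelian group `A`, hence normal in `A ⊔ M =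
⊤`; minimality of `A` finishes. -/
theorem IsMinimalNormal.inf_eq_bot_of_isCoatom {G : Type*} [Group G] [Group.IsSolvable G]
    {A M : Subgroup G} (hA : IsMinimalNormal A) (hM : IsCoatom M) (hAM : ¬ A ≤ M) :
    A ⊓ M = ⊥ := by
  have hAn := hA.normal
  have htop := sup_eq_top_of_isCoatom_of_not_le hM hAM
  have hn : (A ⊓ M).Normal := by
    refine ⟨fun x hx g => ?_⟩
    have hg : g ∈ A ⊔ M := htop ▸ Subgroup.mem_top g
    obtain ⟨a, ha, m, hm, rfl⟩ := Subgroup.mem_sup_of_normal_left.mp hg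
    have h1 : m * x * m⁻¹ ∈ A ⊓ M :=
      ⟨hAn.conj_mem x hx.1 m, M.mul_mem (M.mul_mem hm hx.2) (M.inv_mem hm)⟩
    have h2 : a * m * x * (a * m)⁻¹ = m * x * m⁻¹ := by
      have := hA.commute ha h1.1
      calc a * m * x * (a * m)⁻¹ = a * (m * x * m⁻¹) * a⁻¹ := by group
        _ = m * x * m⁻¹ := by rw [this]; group
    rwa [h2]
  by_contra h
  exact hAM (inf_eq_left.mp (hA.eq_of_le _ hn inf_le_left h))

theorem IsMinimalNormal.le_centralizer {G : Type*} [Group G] [Group.IsSolvable G]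
    {A : Subgroup G} (hA : IsMinimalNormal A) : A ≤ Subgroup.centralizer (A : Set G) :=
  fun _ hx => Subgroup.mem_centralizer_iff.mpr fun _ hy => hA.commute hy hx

theorem inf_centralizer_mem_normalComplements {G : Type*} [Group G] [Group.IsSolvable G]
    {A M : Subgroup G} (hA : IsMinimalNormal A) (hM : IsCoatom M) (hAM : ¬ A ≤ M) :
    M ⊓ Subgroup.centralizer (A : Set G) ∈
      normalComplements A ⊥ (Subgroup.centralizer (A : Set G)) := by
  have hAn := hA.normal
  have htop := sup_eq_top_of_isCoatom_of_not_le hM hAM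
  have hC : (Subgroup.centralizer (A : Set G)).Normal := Subgroup.normal_centralizer
  refine ⟨⟨fun x hx g => ?_⟩, bot_le, ?_, ?_⟩
  · have hg : g ∈ M ⊔ A := by rw [sup_comm, htop]; exact Subgroup.mem_top g
    obtain ⟨m, hm, a, ha, rfl⟩ := Subgroup.mem_sup_of_normal_right.mp hg
    have h1 : a * x = x * a := Subgroup.mem_centralizer_iff.mp hx.2 a ha
    have h2 : m * a * x * (m * a)⁻¹ = m * x * m⁻¹ := by
      calc m * a * x * (m * a)⁻¹ = m * (a * x) * a⁻¹ * m⁻¹ := by group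
        _ = m * x * m⁻¹ := by rw [h1]; group
    rw [h2]
    exact ⟨M.mul_mem (M.mul_mem hm hx.1) (M.inv_mem hm), hC.conj_mem x hx.2 m⟩
  · rw [← inf_assoc, hA.inf_eq_bot_of_isCoatom hM hAM, bot_inf_eq]
  · refine le_antisymm (sup_le hA.le_centralizer inf_le_right) ?_
    intro x hx
    have hg : x ∈ A ⊔ M := by rw [htop]; exact Subgroup.mem_top x
    obtain ⟨a, ha, m, hm, rfl⟩ := Subgroup.mem_sup_of_normal_left.mp hg
    refine Subgroup.mul_mem_sup ha ⟨hm, ?_⟩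
    simpa using Subgroup.mul_mem _ (Subgroup.inv_mem _ (hA.le_centralizer ha)) hx

/-- If a minimal normal `p`-subgroup `A` is not central, some normal subgroup `L` properly
containing the centralizer of `A` is an `r`-group modulo this centralizer, for a prime `r ≠ p`. -/
theorem exists_normal_gt_centralizer {G : Type*} [Group G] [Finite G] [Group.IsSolvable G]
    {A : Subgroup G} (hA : IsMinimalNormal A) {p : ℕ} (hp : p.Prime) (hpA : IsPGroup p A)
    (hC : Subgroup.centralizer (A : Set G) ≠ ⊤) :
    ∃ (r : ℕ) (L : Subgroup G), r.Prime ∧ r ≠ p ∧ L.Normal ∧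
      Subgroup.centralizer (A : Set G) < L ∧
      ∀ x ∈ L, ∃ k : ℕ, x ^ r ^ k ∈ Subgroup.centralizer (A : Set G) := by
  have hAn := hA.normal
  have hCn : (Subgroup.centralizer (A : Set G)).Normal := Subgroup.normal_centralizer
  set C := Subgroup.centralizer (A : Set G) with hCdef
  have : Nontrivial (G ⧸ C) := QuotientGroup.nontrivial_iff.mpr hC
  obtain ⟨B, hB⟩ := exists_isMinimalNormal (G ⧸ C)
  obtain ⟨r, hr, hrB⟩ := hB.exists_isPGroup
  have hBn := hB.normal
  let L := B.comap (QuotientGroup.mk' C)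
  have hLn : L.Normal := inferInstance
  have hCL : C ≤ L := by
    intro x hx
    have : QuotientGroup.mk' C x = 1 := (QuotientGroup.eq_one_iff x).mpr hx
    rw [Subgroup.mem_comap, this]
    exact B.one_mem
  have hpow : ∀ x ∈ L, ∃ k : ℕ, x ^ r ^ k ∈ C := by
    intro x hx
    obtain ⟨k, hk⟩ := hrB ⟨_, hx⟩
    refine ⟨k, (QuotientGroup.eq_one_iff _).mp ?_⟩
    simpa using congrArg Subtype.val hk
  have hnle : ¬ L ≤ C := by
    intro h
    apply hB.ne_bot
    rw [eq_bot_iff]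
    intro b hb
    obtain ⟨x, rfl⟩ := QuotientGroup.mk'_surjective C b
    exact (QuotientGroup.eq_one_iff x).mpr (h hb)
  refine ⟨r, L, hr, ?_, hLn, lt_of_le_not_ge hCL hnle, hpow⟩
  rintro rfl
  apply hnle
  have : Fact r.Prime := ⟨hr⟩
  -- If `r = p`, then `L` acts on the `p`-group `A` as a `p`-group and so fixes some `b ≠ 1`. The
  -- fixed points form the normal subgroup `A ⊓ centralizer L`, which must be `A`, forcing `L ≤ C`.
  have hP : IsPGroup r (L.map (MulAut.conjNormal (H := A))) := by
    rintro ⟨_, x, hx, rfl⟩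
    obtain ⟨k, hk⟩ := hpow x hx
    refine ⟨k, Subtype.ext ?_⟩
    change MulAut.conjNormal x ^ r ^ k = 1
    rw [← map_pow]
    ext a
    rw [MulAut.conjNormal_apply, ← Subgroup.mem_centralizer_iff.mp hk a a.2]
    simp
  have hdvd : r ∣ Nat.card A := by
    obtain ⟨n, hn⟩ := IsPGroup.iff_card.mp hpA
    rw [hn]
    refine dvd_pow_self r fun h => hA.ne_bot ?_
    rw [← Subgroup.card_eq_one, hn, h, pow_zero]
  obtain ⟨b, hb, hb1⟩ := hP.exists_fixed_point_of_prime_dvd_card_of_fixed_point A hdvd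
    (a := 1) (fun g => map_one (g : MulAut A))
  have hbL : (b : G) ∈ Subgroup.centralizer (L : Set G) := by
    refine Subgroup.mem_centralizer_iff.mpr fun x hx => ?_
    have h1 : (MulAut.conjNormal x) b = b := hb ⟨MulAut.conjNormal x, x, hx, rfl⟩
    have h2 := congrArg Subtype.val h1
    rw [MulAut.conjNormal_apply] at h2
    exact mul_inv_eq_iff_eq_mul.mp h2
  have hCLn : (Subgroup.centralizer (L : Set G)).Normal := Subgroup.normal_centralizer
  have h3 : A ⊓ Subgroup.centralizer (L : Set G) = A := by
    refine hA.eq_of_le _ inferInstance inf_le_left fun h => hb1 (Subtype.ext ?_)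
    have : (b : G) ∈ A ⊓ Subgroup.centralizer (L : Set G) := ⟨b.2, hbL⟩
    rw [h, Subgroup.mem_bot] at this
    exact this.symm
  exact Subgroup.le_centralizer_iff.mp (inf_eq_left.mp h3)

/-- Two maximal complements of a noncentral minimal normal subgroup `A` having the same
intersection with the centralizer of `A` are conjugate. -/
theorem exists_conj_eq_of_inf_centralizer_eq {G : Type*} [Group G] [Finite G] [Group.IsSolvable G]
    {A : Subgroup G} (hA : IsMinimalNormal A)
    (hC : Subgroup.centralizer (A : Set G) ≠ ⊤) {M₁ M₂ : Subgroup G}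
    (hM₁ : IsCoatom M₁) (hAM₁ : ¬ A ≤ M₁) (hM₂ : IsCoatom M₂) (hAM₂ : ¬ A ≤ M₂)
    (h : M₁ ⊓ Subgroup.centralizer (A : Set G) = M₂ ⊓ Subgroup.centralizer (A : Set G)) :
    ∃ a ∈ A, M₂ = M₁.map (MulAut.conj a).toMonoidHom := by
  have hAn := hA.normal
  obtain ⟨p, hp, hpA⟩ := hA.exists_isPGroup
  obtain ⟨r, L, hr, hrp, hLn, hCL, hpow⟩ := exists_normal_gt_centralizer hA hp hpA hC
  have hD := inf_centralizer_mem_normalComplements hA hM₁ hAM₁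
  set C := Subgroup.centralizer (A : Set G) with hCdef
  have hDn := hD.1
  have : Fact r.Prime := ⟨hr⟩
  have hcompl : M₁.index = Nat.card A := by
    refine Subgroup.IsComplement'.index_eq_card (Subgroup.isComplement'_of_disjoint_and_mul_eq_univ
      (disjoint_iff.mpr (hA.inf_eq_bot_of_isCoatom hM₁ hAM₁)) ?_)
    rw [← Subgroup.normal_mul, sup_eq_top_of_isCoatom_of_not_le hM₁ hAM₁, Subgroup.coe_top]
  -- `M₂ ⊓ C = M₁ ⊓ C` is normal in `G` and inside `M₁`, so it acts trivially on `G ⧸ M₁`; thus `M₂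
  -- ⊓ L` acts as an `r`-group on a set of `p`-power size and has a fixed point.
  have hP : IsPGroup r ((M₂ ⊓ L).map (MulAction.toPermHom G (G ⧸ M₁))) := by
    rintro ⟨_, x, hx, rfl⟩
    obtain ⟨k, hk⟩ := hpow x hx.2
    refine ⟨k, Subtype.ext ?_⟩
    change (MulAction.toPermHom G (G ⧸ M₁)) x ^ r ^ k = 1
    rw [← map_pow]
    have hxD : x ^ r ^ k ∈ M₁ ⊓ C := h.ge ⟨M₂.pow_mem hx.1 _, hk⟩
    ext y
    obtain ⟨g, rfl⟩ := QuotientGroup.mk_surjective y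
    change ((x ^ r ^ k * g : G) : G ⧸ M₁) = g
    rw [eq_comm, QuotientGroup.eq, ← mul_assoc]
    have := hDn.conj_mem _ hxD g⁻¹
    rw [inv_inv] at this
    exact this.1
  have hndvd : ¬ r ∣ Nat.card (G ⧸ M₁) := by
    obtain ⟨n, hn⟩ := (have := Fact.mk hp; IsPGroup.iff_card.mp hpA)
    rw [← Subgroup.index_eq_card, hcompl, hn]
    exact fun h => hrp ((Nat.prime_dvd_prime_iff_eq hr hp).mp (hr.dvd_of_dvd_pow h))
  obtain ⟨y, hy⟩ := hP.nonempty_fixed_point_of_prime_not_dvd_card (G ⧸ M₁) hndvd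
  obtain ⟨g, rfl⟩ := QuotientGroup.mk_surjective y
  have hg : g ∈ A ⊔ M₁ := by
    rw [sup_eq_top_of_isCoatom_of_not_le hM₁ hAM₁]; exact Subgroup.mem_top g
  obtain ⟨a, ha, m, hm, rfl⟩ := Subgroup.mem_sup_of_normal_left.mp hg
  refine ⟨a, ha, ?_⟩
  have hS : M₂ ⊓ L ≤ M₁.map (MulAut.conj a).toMonoidHom := by
    intro s hs
    have h1 : ((s * (a * m) : G) : G ⧸ M₁) = ((a * m : G) : G ⧸ M₁) :=
      hy ⟨MulAction.toPermHom G (G ⧸ M₁) s, s, hs, rfl⟩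
    rw [eq_comm, QuotientGroup.eq] at h1
    refine ⟨a⁻¹ * s * a, ?_, by simp [mul_assoc]⟩
    have h2 := M₁.mul_mem (M₁.mul_mem hm h1) (M₁.inv_mem hm)
    have h3 : a⁻¹ * s * a = m * ((a * m)⁻¹ * (s * (a * m))) * m⁻¹ := by group
    rw [h3]
    exact h2
  set M₃ := M₁.map (MulAut.conj a).toMonoidHom with hM₃def
  have hAA : A.map (MulAut.conj a).toMonoidHom = A := Subgroup.Normal.map_conj_eq A a
  have hM₃ : A ⊓ M₃ = ⊥ := by
    rw [← hAA, hM₃def, ← Subgroup.map_inf _ _ _ (MulAut.conj a).injective,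
      hA.inf_eq_bot_of_isCoatom hM₁ hAM₁, Subgroup.map_bot]
  have hM₃' : IsCoatom M₃ := (OrderIso.isCoatom_iff (MulAut.conj a).mapSubgroup M₁).mpr hM₁
  have hAL : A ≤ L := hA.le_centralizer.trans hCL.le
  have hLsup : L ≤ A ⊔ (M₂ ⊓ L) := by
    intro x hx
    have hg : x ∈ A ⊔ M₂ := by
      rw [sup_eq_top_of_isCoatom_of_not_le hM₂ hAM₂]; exact Subgroup.mem_top x
    obtain ⟨b, hb, m, hm, rfl⟩ := Subgroup.mem_sup_of_normal_left.mp hg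
    exact Subgroup.mul_mem_sup hb ⟨hm, by simpa using L.mul_mem (L.inv_mem (hAL hb)) hx⟩
  have hSeq : M₃ ⊓ L = M₂ ⊓ L := by
    refine le_antisymm ?_ (le_inf hS inf_le_right)
    have h1 : (A ⊔ (M₂ ⊓ L)) ⊓ M₃ ≤ (A ⊓ M₃) ⊔ (M₂ ⊓ L) := Subgroup.sup_inf_le_of_normal hS
    rw [hM₃, bot_sup_eq] at h1
    exact (le_inf (inf_le_right.trans hLsup) inf_le_left).trans h1
  -- Otherwise `M₂` and `M₃` generate `G` and both normalize `M₂ ⊓ L`. Being normal and disjoint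
  -- from `A`, it centralizes `A`, whence `L ≤ A ⊔ (M₂ ⊓ L) ≤ C`.
  by_contra hne
  have hnorm : ∀ M : Subgroup G, M ≤ Subgroup.normalizer ((M ⊓ L : Subgroup G) : Set G) := by
    intro M x hx
    refine Subgroup.mem_normalizer_iff.mpr fun y => ⟨fun hy => ?_, fun hy => ?_⟩
    · exact ⟨M.mul_mem (M.mul_mem hx hy.1) (M.inv_mem hx), hLn.conj_mem y hy.2 x⟩
    · have h1 := M.mul_mem (M.mul_mem (M.inv_mem hx) hy.1) hx
      have h2 := hLn.conj_mem _ hy.2 x⁻¹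
      have h3 : x⁻¹ * (x * y * x⁻¹) * x = y := by group
      rw [inv_inv, h3] at h2
      rw [h3] at h1
      exact ⟨h1, h2⟩
  have htop : M₂ ⊔ M₃ = ⊤ := hM₂.2 _ (lt_of_le_of_ne le_sup_left fun h' =>
    hne (by
      rcases (hM₃'.le_iff.mp (h' ▸ le_sup_right : M₃ ≤ M₂)) with h4 | h4
      · exact absurd h4 hM₂.1
      · exact h4))
  have hSn : (M₂ ⊓ L).Normal := by
    rw [← Subgroup.normalizer_eq_top_iff, eq_top_iff, ← htop]
    exact sup_le (hnorm M₂) (hSeq ▸ hnorm M₃)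
  have hSC : M₂ ⊓ L ≤ C := by
    intro s hs
    refine Subgroup.mem_centralizer_iff.mpr fun b hb => ?_
    refine Subgroup.commute_of_normal_of_disjoint A _ hAn hSn (disjoint_iff.mpr ?_) _ _ hb hs
    rw [← inf_assoc, hA.inf_eq_bot_of_isCoatom hM₂ hAM₂, bot_inf_eq]
  exact hCL.not_ge (hLsup.trans (sup_le hA.le_centralizer hSC))

theorem ncard_isCoatom_not_ge_le {G : Type*} [Group G] [Finite G] [Group.IsSolvable G]
    {A : Subgroup G} (hA : IsMinimalNormal A) (hC : Subgroup.centralizer (A : Set G) ≠ ⊤) :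
    {M : Subgroup G | IsCoatom M ∧ ¬ A ≤ M}.ncard ≤
      Nat.card A * (normalComplements A ⊥ (Subgroup.centralizer (A : Set G))).ncard := by
  refine Set.ncard_le_mul_ncard_of_fiber (Set.toFinite _) (Set.toFinite _)
    (fun M => M ⊓ Subgroup.centralizer (A : Set G)) _
    (fun M hM => inf_centralizer_mem_normalComplements hA hM.1 hM.2) fun M₁ hM₁ => ?_
  calc _ ≤ ((fun a => M₁.map (MulAut.conj a).toMonoidHom) '' (A : Set G)).ncard := by
        refine Set.ncard_le_ncard ?_ (Set.toFinite _)
        rintro M₂ ⟨hM₂, h⟩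
        obtain ⟨a, ha, rfl⟩ :=
          exists_conj_eq_of_inf_centralizer_eq hA hC hM₁.1 hM₁.2 hM₂.1 hM₂.2 h.symm
        exact ⟨a, ha, rfl⟩
    _ ≤ (A : Set G).ncard := Set.ncard_image_le (Set.toFinite _)
    _ = Nat.card A := rfl

/-! ### Counting maximal subgroups. -/

theorem ncard_isCoatom_ge_le {G : Type*} [Group G] [Finite G] (A : Subgroup G) [A.Normal] :
    {M : Subgroup G | IsCoatom M ∧ A ≤ M}.ncard ≤
      {M : Subgroup (G ⧸ A) | IsCoatom M}.ncard := by
  have hcm : ∀ M : Subgroup G, A ≤ M →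
      (M.map (QuotientGroup.mk' A)).comap (QuotientGroup.mk' A) = M := by
    intro M hM
    rw [Subgroup.comap_map_eq, QuotientGroup.ker_mk', sup_eq_left.mpr hM]
  refine Set.ncard_le_ncard_of_injOn (fun M => M.map (QuotientGroup.mk' A)) ?_ ?_ (Set.toFinite _)
  · rintro M ⟨hM, hAM⟩
    refine ⟨fun h => hM.1 ?_, fun K hK => ?_⟩
    · rw [← hcm M hAM, h, Subgroup.comap_top]
    · have hlt : M < K.comap (QuotientGroup.mk' A) := by
        rw [← hcm M hAM]
        exact (Subgroup.comap_lt_comap_of_surjective (QuotientGroup.mk'_surjective A)).mpr hK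
      rw [← Subgroup.map_comap_eq_self_of_surjective (QuotientGroup.mk'_surjective A) K,
        hM.2 _ hlt, Subgroup.map_top_of_surjective _ (QuotientGroup.mk'_surjective A)]
  · rintro M ⟨-, hM⟩ N ⟨-, hN⟩ h
    rw [← hcm M hM, ← hcm N hN]
    exact congrArg _ h

theorem Subgroup.centralizer_eq_top_of_card_eq_two {G : Type*} [Group G] {A : Subgroup G}
    [hA : A.Normal] (h : Nat.card A = 2) : Subgroup.centralizer (A : Set G) = ⊤ := by
  obtain ⟨a, ha, huniq⟩ := (Nat.card_eq_two_iff' (1 : A)).mp h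
  rw [eq_top_iff]
  intro g _
  refine Subgroup.mem_centralizer_iff.mpr fun x hx => ?_
  by_cases hx1 : x = 1
  · simp [hx1]
  have h1 : (⟨x, hx⟩ : A) = a := huniq _ fun h => hx1 (congrArg Subtype.val h)
  have h2 : (⟨g * x * g⁻¹, hA.conj_mem x hx g⟩ : A) = a := huniq _ fun h => hx1 (by
    have h3 : g * x * g⁻¹ = 1 := congrArg Subtype.val h
    simpa using h3)
  have h3 : g * x * g⁻¹ = x := congrArg Subtype.val (h2.trans h1.symm)
  exact (mul_inv_eq_iff_eq_mul.mp h3).symm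

/-- A complement `D` embeds in `G ⧸ A`, so it has exponent dividing `2`; as `|A| = 3` and `A`
centralizes `D`, it consists exactly of the elements of the centralizer with square `1`. -/
theorem ncard_normalComplements_le_one {G : Type*} [Group G] [Finite G] {A : Subgroup G}
    [A.Normal] (hcard : Nat.card A = 3) (hq : ∀ x : G ⧸ A, x ^ 2 = 1) :
    (normalComplements A ⊥ (Subgroup.centralizer (A : Set G))).ncard ≤ 1 := by
  have hsq : ∀ D ∈ normalComplements A ⊥ (Subgroup.centralizer (A : Set G)),
      ∀ d ∈ D, d ^ 2 = 1 := by
    intro D hD d hd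
    have h1 : d ^ 2 ∈ A := (QuotientGroup.eq_one_iff (d ^ 2)).mp (hq d)
    have h2 : d ^ 2 ∈ A ⊓ D := ⟨h1, D.pow_mem hd 2⟩
    rwa [hD.2.2.1, Subgroup.mem_bot] at h2
  have hle : ∀ D ∈ normalComplements A ⊥ (Subgroup.centralizer (A : Set G)),
      ∀ E ∈ normalComplements A ⊥ (Subgroup.centralizer (A : Set G)), D ≤ E := by
    intro D hD E hE d hd
    have h1 : d ∈ A ⊔ E := by
      rw [hE.2.2.2, ← hD.2.2.2]; exact Subgroup.mem_sup_right hd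
    obtain ⟨a, ha, e, he, rfl⟩ := Subgroup.mem_sup_of_normal_left.mp h1
    have hae : Commute a e := Subgroup.mem_centralizer_iff.mp
      (hE.2.2.2.le (Subgroup.mem_sup_right he)) a ha
    have h2 := hsq D hD _ hd
    rw [hae.mul_pow, hsq E hE e he, mul_one] at h2
    have h3 : a ^ 3 = 1 := by
      have := pow_card_eq_one' (x := (⟨a, ha⟩ : A))
      rw [hcard] at this
      exact congrArg Subtype.val this
    have h4 : a = 1 := by rwa [pow_succ, h2, one_mul] at h3
    rwa [h4, one_mul]
  exact (Set.ncard_le_one (Set.toFinite _)).mpr fun D hD E hE =>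
    le_antisymm (hle D hD E hE) (hle E hE D hD)

/-- The complements have index `2`, so they all contain the nontrivial normal subgroup `K` generated
by squares; this gains a factor `|K| ≥ 2` in the general count. -/
theorem four_mul_ncard_normalComplements_le {G : Type*} [Group G] [Finite G] {A : Subgroup G}
    (hA : IsMinimalNormal A) (hcard : Nat.card A = 2) (hG : ¬ ∀ x : G, x ^ 2 = 1) :
    4 * (normalComplements A ⊥ ⊤).ncard ≤ Nat.card G := by
  have hAn := hA.normal
  let K := Subgroup.normalClosure (Set.range fun x : G => x ^ 2)
  have hK : K ≠ ⊥ := by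
    intro h
    refine hG fun x => ?_
    have : x ^ 2 ∈ K := Subgroup.subset_normalClosure ⟨x, rfl⟩
    rwa [h, Subgroup.mem_bot] at this
  have hsub : normalComplements A ⊥ ⊤ ⊆ normalComplements A K ⊤ := by
    rintro D ⟨hD, -, hAD, hsup⟩
    refine ⟨hD, Subgroup.normalClosure_le_normal ?_, hAD, hsup⟩
    rintro _ ⟨x, rfl⟩
    refine Subgroup.sq_mem_of_index_two ?_ x
    rw [← hcard]
    refine Subgroup.IsComplement'.index_eq_card (Subgroup.isComplement'_of_disjoint_and_mul_eq_univ
      (disjoint_iff.mpr hAD) ?_)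
    rw [← Subgroup.normal_mul, hsup, Subgroup.coe_top]
  have h1 := ncard_normalComplements_mul_le hA K ⊤
  have h2 := Set.ncard_le_ncard hsub
  have h3 := (Subgroup.one_lt_card_iff_ne_bot K).mpr hK
  rw [hcard, Subgroup.card_top] at h1
  calc 4 * (normalComplements A ⊥ ⊤).ncard
      ≤ (normalComplements A K ⊤).ncard * (2 * 2) := by omega
    _ ≤ (normalComplements A K ⊤).ncard * (2 * Nat.card K) := by gcongr; exact h3
    _ ≤ Nat.card G := h1

/-- A finite solvable group has fewer than `3 |G| / 4` maximal subgroups, unless it has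
exponent dividing `2`. -/
theorem four_mul_ncard_isCoatom_lt (G : Type*) [Group G] [Finite G] [Group.IsSolvable G] :
    4 * {M : Subgroup G | IsCoatom M}.ncard < 3 * Nat.card G ∨
      ((∀ x : G, x ^ 2 = 1) ∧ {M : Subgroup G | IsCoatom M}.ncard < Nat.card G) := by
  induction hn : Nat.card G using Nat.strong_induction_on generalizing G with
  | _ n ih =>
  subst hn
  rcases subsingleton_or_nontrivial G with hG | hG
  · left
    have : {M : Subgroup G | IsCoatom M} = ∅ :=
      Set.eq_empty_of_forall_notMem fun M hM => hM.1 (Subsingleton.elim _ _)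
    rw [this, Set.ncard_empty]
    have := Nat.card_pos (α := G)
    omega
  obtain ⟨A, hA⟩ := exists_isMinimalNormal G
  have hAn := hA.normal
  have hA1 := (Subgroup.one_lt_card_iff_ne_bot A).mpr hA.ne_bot
  have hcard := Subgroup.card_eq_card_quotient_mul_card_subgroup A
  have hQ : 0 < Nat.card (G ⧸ A) := Nat.card_pos
  have hlt : Nat.card (G ⧸ A) < Nat.card G := by rw [hcard]; nlinarith
  have hih := ih _ hlt (G ⧸ A) rfl
  have hsum : {M : Subgroup G | IsCoatom M}.ncard ≤ {M : Subgroup (G ⧸ A) | IsCoatom M}.ncard +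
      {M : Subgroup G | IsCoatom M ∧ ¬ A ≤ M}.ncard := by
    have : {M : Subgroup G | IsCoatom M} =
        {M | IsCoatom M ∧ A ≤ M} ∪ {M | IsCoatom M ∧ ¬ A ≤ M} := by
      ext M; simp only [Set.mem_ofPred_eq, Set.mem_union]; tauto
    calc _ ≤ _ := (congrArg Set.ncard this).le.trans (Set.ncard_union_le _ _)
      _ ≤ _ := Nat.add_le_add_right (ncard_isCoatom_ge_le A) _
  have hlt' : {M : Subgroup (G ⧸ A) | IsCoatom M}.ncard < Nat.card (G ⧸ A) := by
    rcases hih with h | h <;> omega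
  have hT := ncard_normalComplements_mul_le hA ⊥ (Subgroup.centralizer (A : Set G))
    (hX := Subgroup.normal_centralizer)
  rw [Subgroup.card_bot, mul_one] at hT
  generalize {M : Subgroup G | IsCoatom M}.ncard = m at *
  by_cases hC : Subgroup.centralizer (A : Set G) = ⊤
  · have hsub : {M : Subgroup G | IsCoatom M ∧ ¬ A ≤ M} ⊆ normalComplements A ⊥ ⊤ := by
      rintro M ⟨hM, hAM⟩
      simpa [hC] using inf_centralizer_mem_normalComplements hA hM hAM
    have hle := Set.ncard_le_ncard hsub
    rw [hC, Subgroup.card_top] at hT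
    have hle' : (normalComplements A ⊥ ⊤).ncard ≤ Nat.card (G ⧸ A) :=
      Nat.le_of_mul_le_mul_right (hT.trans hcard.le) (by omega)
    -- Here `m < 2 |G ⧸ A|`, which is at most `2 |G| / 3` when `|A| ≥ 3`; for `|A| = 2` the bound
    -- `|G| / 4` on complements is needed.
    rcases (show Nat.card A = 2 ∨ 3 ≤ Nat.card A by omega) with h2 | h3
    · by_cases hel : ∀ x : G, x ^ 2 = 1
      · exact Or.inr ⟨hel, by rw [h2] at hcard; omega⟩
      · left
        have := four_mul_ncard_normalComplements_le hA h2 hel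
        rw [h2] at hcard
        omega
    · left
      have : Nat.card (G ⧸ A) * 3 ≤ Nat.card G := by rw [hcard]; gcongr
      omega
  · left
    have hle := ncard_isCoatom_not_ge_le hA hC
    have hA2 : Nat.card A ≠ 2 := fun h => hC (Subgroup.centralizer_eq_top_of_card_eq_two h)
    have hidx : 2 * Nat.card (Subgroup.centralizer (A : Set G)) ≤ Nat.card G := by
      rw [← Subgroup.card_mul_index (Subgroup.centralizer (A : Set G)), mul_comm]
      gcongr
      exact Subgroup.one_lt_index_of_ne_top hC
    rw [mul_comm] at hT
    -- At most `|C| ≤ |G| / 2` maximal subgroups avoid `A`, so fewer than `|G| / 4` containing `A`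
    -- suffice. Only `|A| = 3` with `G ⧸ A` of exponent dividing `2` escapes this; there at most
    -- three avoid `A`.
    rcases (show Nat.card A = 3 ∨ 4 ≤ Nat.card A by omega) with h3 | h4
    · rcases hih with h | ⟨h, -⟩
      · rw [h3] at hcard; omega
      · have h1 := ncard_normalComplements_le_one h3 h
        have h2 : Nat.card A ≤ Nat.card (Subgroup.centralizer (A : Set G)) :=
          Nat.card_mono (Set.toFinite _) hA.le_centralizer
        rw [h3] at hcard hle h2
        omega
    · have : Nat.card (G ⧸ A) * 4 ≤ Nat.card G := by rw [hcard]; gcongr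
      omega

/-! ### Counting subgroups of prime order. -/

/-- The weight counting subgroups of prime order twice: `2` for involutions, `1` for other elements
of prime order and `0` for the remaining elements. -/
noncomputable def primeOrderWeight {G : Type*} [Group G] (g : G) : ℕ :=
  open Classical in if orderOf g = 2 then 2 else if (orderOf g).Prime then 1 else 0

theorem primeOrderWeight_of_orderOf_eq_two {G : Type*} [Group G] {g : G} (h : orderOf g = 2) :
    primeOrderWeight g = 2 := by
  simp [primeOrderWeight, h]

theorem primeOrderWeight_le_one {G : Type*} [Group G] {g : G} (h : orderOf g ≠ 2) :
    primeOrderWeight g ≤ 1 := by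
  rw [primeOrderWeight, if_neg h]
  split_ifs <;> simp

theorem primeOrderWeight_le_two {G : Type*} [Group G] (g : G) : primeOrderWeight g ≤ 2 := by
  by_cases h : orderOf g = 2
  · exact (primeOrderWeight_of_orderOf_eq_two h).le
  · exact (primeOrderWeight_le_one h).trans one_le_two

theorem primeOrderWeight_of_not_prime {G : Type*} [Group G] {g : G} (h : ¬ (orderOf g).Prime) :
    primeOrderWeight g = 0 := by
  have h2 : orderOf g ≠ 2 := fun h2 => h (by rw [h2]; exact Nat.prime_two)
  rw [primeOrderWeight, if_neg h2, if_neg h]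

theorem primeOrderWeight_of_prime {G : Type*} [Group G] {g : G} (h : (orderOf g).Prime)
    (h2 : orderOf g ≠ 2) : primeOrderWeight g = 1 := by
  rw [primeOrderWeight, if_neg h2, if_pos h]

/-- Each atom is cyclic of prime order: one generator of weight `2` if that order is `2`, and
otherwise at least the two generators `g ≠ g⁻¹` of weight `1`. -/
theorem two_mul_ncard_isAtom_le {G : Type*} [Group G] [Fintype G] :
    2 * {A : Subgroup G | IsAtom A}.ncard ≤ ∑ g : G, primeOrderWeight g := by
  classical
  have := Fintype.ofFinite (Subgroup G)
  rw [Set.ncard_eq_toFinset_card', mul_comm, ← smul_eq_mul, ← Finset.sum_const,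
    ← Finset.sum_fiberwise Finset.univ (fun g : G => Subgroup.zpowers g) primeOrderWeight]
  refine (Finset.sum_le_sum fun A hA => ?_).trans (Finset.sum_le_sum_of_subset
    (Finset.subset_univ _))
  replace hA : IsAtom A := by simpa using hA
  have hcard : Nat.card A ≠ 1 := by rw [Ne, Subgroup.card_eq_one]; exact hA.1
  obtain ⟨p, hp, hpA⟩ := Nat.exists_prime_and_dvd hcard
  have : Fact p.Prime := ⟨hp⟩
  obtain ⟨⟨g, hgA⟩, hg⟩ := exists_prime_orderOf_dvd_card' (G := A) p hpA
  rw [Subgroup.orderOf_mk] at hg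
  have hz : Subgroup.zpowers g = A := by
    refine (hA.le_iff.mp (Subgroup.zpowers_le.mpr hgA)).resolve_left fun h => ?_
    rw [Subgroup.zpowers_eq_bot] at h
    rw [h, orderOf_one] at hg
    exact hp.one_lt.ne hg
  by_cases h2 : p = 2
  · rw [← primeOrderWeight_of_orderOf_eq_two (hg.trans h2)]
    exact Finset.single_le_sum (f := primeOrderWeight) (fun _ _ => Nat.zero_le _)
      (by simp [hz])
  · have hne : g ≠ g⁻¹ := by
      intro h
      have h1 : g ^ 2 = 1 := by rw [sq]; exact mul_eq_one_iff_eq_inv.mpr h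
      have h3 := orderOf_dvd_of_pow_eq_one h1
      rw [hg] at h3
      exact h2 ((Nat.prime_dvd_prime_iff_eq hp Nat.prime_two).mp h3)
    have hsub : ({g, g⁻¹} : Finset G) ⊆
        Finset.univ.filter fun y => Subgroup.zpowers y = A := by
      intro y hy
      rcases Finset.mem_insert.mp hy with rfl | hy
      · simpa using hz
      · rw [Finset.mem_singleton.mp hy]
        simpa [Subgroup.zpowers_inv] using hz
    have hsum : ∑ y ∈ ({g, g⁻¹} : Finset G), primeOrderWeight y = 2 := by
      rw [Finset.sum_pair hne, primeOrderWeight_of_prime (hg ▸ hp) (hg ▸ h2),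
        primeOrderWeight_of_prime (by rw [orderOf_inv, hg]; exact hp)
          (by rw [orderOf_inv, hg]; exact h2)]
    rw [← hsum]
    exact Finset.sum_le_sum_of_subset hsub

/-- The product has order `4` or twice an odd prime. -/
theorem primeOrderWeight_mul_eq_zero {G : Type*} [Group G] {h y : G} (hc : Commute h y)
    (h2 : orderOf h = 2) (hy : orderOf y = 4 ∨ ((orderOf y).Prime ∧ orderOf y ≠ 2)) :
    primeOrderWeight (h * y) = 0 := by
  refine primeOrderWeight_of_not_prime ?_
  rcases hy with hy | ⟨hy, hy2⟩
  · have hh : h ^ 2 = 1 := h2 ▸ pow_orderOf_eq_one h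
    have : orderOf (h * y) = 2 ^ (1 + 1) := by
      have : Fact (Nat.Prime 2) := ⟨Nat.prime_two⟩
      refine orderOf_eq_prime_pow ?_ ?_
      · rw [pow_one, hc.mul_pow, hh, one_mul]
        exact pow_ne_one_of_lt_orderOf (by norm_num) (by rw [hy]; norm_num)
      · have hy4 : y ^ 4 = 1 := hy ▸ pow_orderOf_eq_one y
        have hh4 : h ^ 4 = 1 := by rw [show 4 = 2 * 2 from rfl, pow_mul, hh, one_pow]
        rw [show 2 ^ (1 + 1) = 4 from rfl, hc.mul_pow, hh4, hy4, one_mul]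
    rw [this]
    norm_num
  · have hco : (orderOf h).Coprime (orderOf y) := by
      rw [h2]
      exact (Nat.coprime_primes Nat.prime_two hy).mpr (Ne.symm hy2)
    rw [hc.orderOf_mul_eq_mul_orderOf_of_coprime hco, h2]
    exact Nat.not_prime_mul (by norm_num) hy.one_lt.ne'

/-- A finite group that has an element of order greater than `2` has fewer than `3 |G| / 4`
subgroups of prime order. -/
theorem four_mul_ncard_isAtom_lt {G : Type*} [Group G] [Finite G] (hG : ¬ ∀ x : G, x ^ 2 = 1) :
    4 * {A : Subgroup G | IsAtom A}.ncard < 3 * Nat.card G := by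
  classical
  have := Fintype.ofFinite G
  obtain ⟨x, hx⟩ : ∃ x : G, orderOf x = 4 ∨ ((orderOf x).Prime ∧ orderOf x ≠ 2) := by
    push Not at hG
    obtain ⟨z, hz⟩ := hG
    have hz0 : 0 < orderOf z := orderOf_pos z
    have hz2 : 2 < orderOf z := by
      by_contra h
      have : orderOf z ∣ 2 := by
        rcases (show orderOf z = 1 ∨ orderOf z = 2 by omega) with h | h <;> simp [h]
      exact hz (orderOf_dvd_iff_pow_eq_one.mp this)
    rcases Nat.four_dvd_or_exists_odd_prime_and_dvd_of_two_lt hz2 with h | ⟨p, hp, hpz, hodd⟩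
    · exact ⟨_, Or.inl (orderOf_pow_orderOf_div hz0.ne' h)⟩
    · refine ⟨z ^ (orderOf z / p), Or.inr ?_⟩
      rw [orderOf_pow_orderOf_div hz0.ne' hpz]
      exact ⟨hp, fun h => by rw [h] at hodd; exact absurd hodd (by decide)⟩
  have hx2 : x ^ 2 ≠ 1 := by
    refine pow_ne_one_of_lt_orderOf (by norm_num) ?_
    rcases hx with h | ⟨h, h'⟩
    · rw [h]; norm_num
    · exact lt_of_le_of_ne h.two_le (Ne.symm h')
  have hxinv : orderOf x⁻¹ = 4 ∨ ((orderOf x⁻¹).Prime ∧ orderOf x⁻¹ ≠ 2) := by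
    rwa [orderOf_inv]
  have hsq : ∀ g : G, orderOf g = 2 → g * g = 1 := fun g h => by
    rw [← sq, ← h]; exact pow_orderOf_eq_one g
  -- The value `4` requires `g` and `g * x` both to be involutions, which makes `g` invert `x`. If
  -- `g` commutes with `x`, an involution in the pair forces the other weight to be `0`.
  let b : G → ℕ := fun g => if Commute g x then 2 else if g * x = x⁻¹ * g then 4 else 3
  have hb : ∀ g : G, primeOrderWeight g + primeOrderWeight (g * x) ≤ b g := by
    intro g
    have h1 := primeOrderWeight_le_two g
    have h2 := primeOrderWeight_le_two (g * x)
    by_cases hc : Commute g x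
    · simp only [b, if_pos hc]
      by_cases h3 : orderOf g = 2
      · rw [primeOrderWeight_mul_eq_zero hc h3 hx]; exact h1
      by_cases h4 : orderOf (g * x) = 2
      · have h5 : Commute (g * x) x⁻¹ := (hc.mul_left (Commute.refl x)).inv_right
        have h6 := primeOrderWeight_mul_eq_zero h5 h4 hxinv
        rw [mul_inv_cancel_right] at h6
        rw [h6, zero_add]; exact h2
      · have := primeOrderWeight_le_one h3
        have := primeOrderWeight_le_one h4
        omega
    · simp only [b, if_neg hc]
      split_ifs with hi
      · omega
      · by_cases h3 : orderOf g = 2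
        · by_cases h4 : orderOf (g * x) = 2
          · refine absurd ?_ hi
            have h5 := hsq _ h4
            have h6 : g⁻¹ = g := inv_eq_of_mul_eq_one_left (hsq _ h3)
            have h7 := eq_inv_of_mul_eq_one_left h5
            rwa [mul_inv_rev, h6] at h7
          · have := primeOrderWeight_le_one h4
            omega
        · have := primeOrderWeight_le_one h3
          omega
  -- The pair `1, x` makes the final inequality strict.
  have hb1 : primeOrderWeight (1 : G) + primeOrderWeight (1 * x) < b 1 := by
    have h1 : primeOrderWeight (1 : G) = 0 :=
      primeOrderWeight_of_not_prime (by rw [orderOf_one]; norm_num)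
    have h2 : primeOrderWeight x ≤ 1 := primeOrderWeight_le_one fun h =>
      hx2 (h ▸ pow_orderOf_eq_one x)
    have h3 : b 1 = 2 := if_pos (Commute.one_left x)
    rw [h1, h3, one_mul]
    omega
  have hlt : ∑ g : G, (primeOrderWeight g + primeOrderWeight (g * x)) < ∑ g : G, b g :=
    Finset.sum_lt_sum (fun g _ => hb g) ⟨1, Finset.mem_univ _, hb1⟩
  have hshift : ∑ g : G, primeOrderWeight (g * x) = ∑ g : G, primeOrderWeight g :=
    Equiv.sum_comp (Equiv.mulRight x) primeOrderWeight
  rw [Finset.sum_add_distrib, hshift] at hlt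
  -- Elements inverting `x` lie in one coset of its centralizer, so the values `4` are balanced by
  -- the values `2` and `b` averages at most `3`.
  have hle : (Finset.univ.filter fun g : G => ¬ Commute g x ∧ g * x = x⁻¹ * g).card ≤
      (Finset.univ.filter fun g : G => Commute g x).card := by
    by_cases ht : ∃ t : G, t * x = x⁻¹ * t
    · obtain ⟨t, ht⟩ := ht
      refine Finset.card_le_card_of_injOn (fun g => t⁻¹ * g) ?_
        (fun _ _ _ _ h => mul_left_cancel h)
      intro g hg
      have hg' : g * x = x⁻¹ * g := (Finset.mem_filter.mp hg).2.2
      refine Finset.mem_filter.mpr ⟨Finset.mem_univ _, ?_⟩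
      have : x * t⁻¹ = t⁻¹ * x⁻¹ := by
        rw [eq_inv_mul_iff_mul_eq, ← mul_assoc, ht, mul_inv_cancel_right]
      change t⁻¹ * g * x = x * (t⁻¹ * g)
      rw [mul_assoc, hg', ← mul_assoc, ← mul_assoc, this]
    · rw [Finset.card_eq_zero.mpr]
      · exact Nat.zero_le _
      · exact Finset.filter_eq_empty_iff.mpr fun g _ h => ht ⟨g, h.2⟩
  have hsum : ∑ g : G, b g + (Finset.univ.filter fun g : G => Commute g x).card =
      3 * Nat.card G +
        (Finset.univ.filter fun g : G => ¬ Commute g x ∧ g * x = x⁻¹ * g).card := by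
    rw [Nat.card_eq_fintype_card, ← Finset.card_univ, Finset.card_eq_sum_ones Finset.univ,
      Finset.card_filter, Finset.card_filter, Finset.mul_sum, ← Finset.sum_add_distrib,
      ← Finset.sum_add_distrib]
    refine Finset.sum_congr rfl fun g _ => ?_
    by_cases h1 : Commute g x <;> by_cases h2 : g * x = x⁻¹ * g <;> simp [b, h1, h2]
  have := two_mul_ncard_isAtom_le (G := G)
  omega

/-! ### Degrees in the subgroup graph. -/

/-- Distinct covers of `H` meet in `H`, so picking `g K ∈ K \ H` gives distinct cosets of `H`, none
equal to `H`. -/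
theorem ncard_covBy_lt_index {G : Type*} [Group G] [Finite G] (H : Subgroup G) :
    {K : Subgroup G | H ⋖ K}.ncard < H.index := by
  have key : ∀ K : Subgroup G, ∃ g : G, H ⋖ K → g ∈ K ∧ g ∉ H := by
    intro K
    by_cases h : H ⋖ K
    · obtain ⟨g, hg⟩ := SetLike.exists_of_lt h.lt
      exact ⟨g, fun _ => hg⟩
    · exact ⟨1, fun h' => absurd h' h⟩
  choose g hg using key
  have hle : {K : Subgroup G | H ⋖ K}.ncard ≤ ({((1 : G) : G ⧸ H)}ᶜ : Set (G ⧸ H)).ncard := by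
    refine Set.ncard_le_ncard_of_injOn (fun K => (g K : G ⧸ H)) ?_ ?_ (Set.toFinite _)
    · intro K hK h
      have h1 : ((g K : G) : G ⧸ H) = ((1 : G) : G ⧸ H) := h
      rw [eq_comm, QuotientGroup.eq, inv_one, one_mul] at h1
      exact (hg K hK).2 h1
    · intro K hK L hL h
      have h1 : (g K)⁻¹ * g L ∈ H := QuotientGroup.eq.mp h
      have hmem : g K ∈ K ⊓ L := by
        refine ⟨(hg K hK).1, ?_⟩
        have h2 := L.mul_mem (hg L hL).1 (L.inv_mem (hL.le h1))
        simpa using h2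
      have hlt : H < K ⊓ L := lt_of_le_of_ne (le_inf hK.le hL.le) fun h =>
        (hg K hK).2 (h ▸ hmem)
      have hKL : K ⊓ L = K := by
        by_contra hne
        exact hK.2 hlt (lt_of_le_of_ne inf_le_left hne)
      have hLK : K ⊓ L = L := by
        by_contra hne
        exact hL.2 hlt (lt_of_le_of_ne inf_le_right hne)
      exact hKL.symm.trans hLK
  have h1 := Set.ncard_add_ncard_compl ({((1 : G) : G ⧸ H)} : Set (G ⧸ H))
  rw [Set.ncard_singleton, ← Subgroup.index_eq_card] at h1
  omega

theorem ncard_covBy_le_ncard_isCoatom {G : Type*} [Group G] [Finite G] (H : Subgroup G) :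
    {K : Subgroup G | K ⋖ H}.ncard ≤ {M : Subgroup H | IsCoatom M}.ncard := by
  refine Set.ncard_le_ncard_of_injOn (fun K => K.subgroupOf H) ?_ ?_ (Set.toFinite _)
  · intro K hK
    refine ⟨fun h => hK.lt.not_ge (Subgroup.subgroupOf_eq_top.mp h), fun L hL => ?_⟩
    have h1 : K < L.map H.subtype := by
      have := (Subgroup.map_lt_map_iff_of_injective H.subtype_injective).mpr hL
      rwa [Subgroup.subgroupOf_map_subtype, inf_eq_left.mpr hK.le] at this
    have h2 : L.map H.subtype = H := by
      by_contra hne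
      exact hK.2 h1 (lt_of_le_of_ne (Subgroup.map_subtype_le L) hne)
    refine Subgroup.map_injective H.subtype_injective (h2.trans ?_)
    rw [← MonoidHom.range_eq_map, Subgroup.range_subtype]
  · intro K hK L hL h
    have h1 := Subgroup.subgroupOf_inj.mp h
    rwa [inf_eq_left.mpr hK.le, inf_eq_left.mpr hL.le] at h1

theorem degree_subgroupGraph {G : Type*} [Group G] [Finite G] (H : Subgroup G) :
    (subgroupGraph G).degree H = ({K | H ⋖ K} ∪ {K | K ⋖ H} : Set (Subgroup G)).ncard := by
  rw [← SimpleGraph.card_neighborSet_eq_degree, ← Nat.card_eq_fintype_card]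
  rfl

theorem degree_subgroupGraph_le {G : Type*} [Group G] [Finite G] (H : Subgroup G) :
    (subgroupGraph G).degree H ≤ {K | H ⋖ K}.ncard + {K | K ⋖ H}.ncard := by
  rw [degree_subgroupGraph]
  exact Set.ncard_union_le _ _

theorem eq_one_or_eq_of_mem_zpowers {G : Type*} [Group G] {x y : G} (hx : x ^ 2 = 1)
    (hy : y ∈ Subgroup.zpowers x) : y = 1 ∨ y = x := by
  obtain ⟨n, rfl⟩ := Subgroup.mem_zpowers_iff.mp hy
  have hx' : x ^ (2 : ℤ) = 1 := by exact_mod_cast hx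
  rcases Int.even_or_odd' n with ⟨k, rfl | rfl⟩
  · left; rw [zpow_mul, hx', one_zpow]
  · right; rw [zpow_add, zpow_mul, hx', one_zpow, zpow_one, one_mul]

theorem card_le_ncard_isAtom_add_one {G : Type*} [Group G] [Finite G] (hG : ∀ x : G, x ^ 2 = 1) :
    Nat.card G ≤ {A : Subgroup G | IsAtom A}.ncard + 1 := by
  have hle : ({(1 : G)}ᶜ : Set G).ncard ≤ {A : Subgroup G | IsAtom A}.ncard := by
    refine Set.ncard_le_ncard_of_injOn Subgroup.zpowers ?_ ?_ (Set.toFinite _)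
    · intro x hx
      refine ⟨fun h => hx (Subgroup.zpowers_eq_bot.mp h), fun K hK => ?_⟩
      by_contra hne
      obtain ⟨k, hk, hk1⟩ := (Subgroup.bot_or_exists_ne_one K).resolve_left hne
      refine hK.not_ge (Subgroup.zpowers_le.mpr ?_)
      rcases eq_one_or_eq_of_mem_zpowers (hG x) (hK.le hk) with h | h
      · exact absurd h hk1
      · rwa [← h]
    · intro x hx y hy h
      have hxy : x ∈ Subgroup.zpowers y := h ▸ Subgroup.mem_zpowers x
      exact (eq_one_or_eq_of_mem_zpowers (hG y) hxy).resolve_left hx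
  have h1 := Set.ncard_add_ncard_compl ({(1 : G)} : Set G)
  rw [Set.ncard_singleton] at h1
  omega

theorem isElementaryAbelianTwoGroup_iff {G : Type*} [Group G] :
    IsElementaryAbelianTwoGroup G ↔ ∀ x : G, x ^ 2 = 1 := by
  refine ⟨fun h => h.2, fun h => ⟨fun x y => ?_, h⟩⟩
  have hinv : ∀ z : G, z⁻¹ = z := fun z => inv_eq_of_mul_eq_one_left (by rw [← sq, h z])
  rw [← hinv (x * y), mul_inv_rev, hinv, hinv]

theorem sq_eq_one_of_three_mul_card_le_degree {G : Type*} [Group G] [Finite G]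
    [Group.IsSolvable G] (H : Subgroup G)
    (hH : 3 * Nat.card G ≤ 4 * (subgroupGraph G).degree H) :
    (∀ x : G, x ^ 2 = 1) ∧ 4 ≤ Nat.card G := by
  have hdeg := degree_subgroupGraph_le H
  have hup := ncard_covBy_lt_index H
  have hdown := ncard_covBy_le_ncard_isCoatom H
  have hpos : 0 < Nat.card G := Nat.card_pos
  by_cases hbot : H = ⊥
  · subst hbot
    have h0 : {K : Subgroup G | K ⋖ ⊥} = ∅ :=
      Set.eq_empty_of_forall_notMem fun K hK => not_lt_bot hK.lt
    simp only [h0, Set.ncard_empty, bot_covBy_iff, Subgroup.index_bot] at hdeg hup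
    refine ⟨?_, by omega⟩
    by_contra hG
    have := four_mul_ncard_isAtom_lt hG
    omega
  by_cases htop : H = ⊤
  · subst htop
    have h0 : {K : Subgroup G | ⊤ ⋖ K} = ∅ :=
      Set.eq_empty_of_forall_notMem fun K hK => not_top_lt hK.lt
    simp only [h0, Set.ncard_empty, covBy_top_iff] at hdeg
    rcases four_mul_ncard_isCoatom_lt G with h | ⟨h, h'⟩
    · omega
    · exact ⟨h, by omega⟩
  exfalso
  have hlt : {M : Subgroup H | IsCoatom M}.ncard < Nat.card H := by
    rcases four_mul_ncard_isCoatom_lt H with h | h <;> omega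
  have h1 := (Subgroup.one_lt_card_iff_ne_bot H).mpr hbot
  have h2 := Subgroup.one_lt_index_of_ne_top htop
  have h3 := Subgroup.card_mul_index H
  obtain ⟨a, ha⟩ := Nat.exists_eq_add_of_le' h1
  obtain ⟨c, hc⟩ := Nat.exists_eq_add_of_le' h2
  rw [ha] at hlt h3
  rw [hc] at hup h3
  -- With `|H| = a + 2` and `|G : H| = c + 2`, the degree is at most `a + c + 2`, while `|G| = (a +
  -- 2) * (c + 2)`.
  nlinarith [Nat.zero_le (a * c)]

theorem corollary1p2 (G : Type*) [Group G] [Finite G] [Group.IsSolvable G] :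
    (∃ H : Subgroup G, (3 * (Nat.card G : ℝ)) / 4 ≤ ((subgroupGraph G).degree H : ℝ)) ↔
      (IsElementaryAbelianTwoGroup G ∧ 4 ≤ Nat.card G) := by
  have hcast : ∀ H : Subgroup G,
      (3 * (Nat.card G : ℝ)) / 4 ≤ ((subgroupGraph G).degree H : ℝ) ↔
        3 * Nat.card G ≤ 4 * (subgroupGraph G).degree H := by
    intro H
    rw [div_le_iff₀' (by norm_num)]
    exact_mod_cast Iff.rfl
  simp only [hcast, isElementaryAbelianTwoGroup_iff]
  refine ⟨fun ⟨H, hH⟩ => sq_eq_one_of_three_mul_card_le_degree H hH, fun ⟨hG, hcard⟩ => ⟨⊥, ?_⟩⟩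
  have h1 := card_le_ncard_isAtom_add_one hG
  have h2 : {A : Subgroup G | IsAtom A}.ncard ≤ (subgroupGraph G).degree ⊥ := by
    rw [degree_subgroupGraph]
    exact Set.ncard_le_ncard (fun A hA => Or.inl (bot_covBy_iff.mpr hA)) (Set.toFinite _)
  omega
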